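/- Let $\Gamma$ be a distance-regular graph with finite vertex set $X$, path-length distance $\partial$ and diameter $D\ge 1$. Let $A_i\in \mathrm{Mat}_X(\mathbb C)$ $(0\le i\le D)$ be the distance-matrices ($A_i(x,y)=1$ if $\partial(x,y)=i$, and $0$ otherwise), let $M=\mathrm{Span}\{A_i\}_{i=0}^D$ be the Bose–Mesner algebra, and put $k_i=|\{y:\partial(x,y)=i\}|$ (independent of $x\in X$). Let $\{E_i\}_{i=0}^D$ be an ordering of the primitive idempotents of $\Gamma$, i.e. a basis of $M$ with $E_0=|X|^{-1}J$ (where $J$ is the all-ones matrix), $E_iE_j=\delta_{ij}E_i$ and $\sum_i E_i=I$. Assume that $\Gamma$ is formally self-dual with respect to $\{E_i\}$: $P=Q$, where $A_j=\sum_i P_{ij}E_i$ and $E_j=|X|^{-1}\sum_i Q_{ij}A_i$ for $0\le j\le D$. For $x\in X$ let $E_i^*(x)$ be the diagonal matrix with $(y,y)$-entry $1$ if $\partial(x,y)=i$ and $0$ otherwise; let $M^*(x)=\mathrm{Span}\{E_i^*(x)\}_{i=0}^D$; let $A_1^*(x)$ be the diagonal matrix with $(y,y)$-entry $|X|E_1(x,y)$;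 and let $T(x)$ be the subalgebra of $\mathrm{Mat}_X(\mathbb C)$ generated by $M$ and $M^*(x)$. A $T(x)$-module is a $T(x)$-invariant subspace of $V=\mathbb C^X$; it is irreducible if it is nonzero and has no $T(x)$-submodules other than $0$ and itself. An irreducible $T(x)$-module $U$ is thin if $\dim E_i^*(x)U\le 1$ for all $i$; its endpoint is $\min\{i: E_i^*(x)U\ne0\}$ and its dual endpoint is $\min\{i:E_iU\neq 0\}$. A Leonard pair on a finite-dimensional space $U\neq 0$ is a pair of linear maps $A,A^*:U\to U$ such that in some basis $A$ is irreducible tridiagonal and $A^*$ is diagonal, and in some basis $A^*$ is irreducible tridiagonal and $A$ is diagonal (irreducible: all sub- and superdiagonal entries are nonzero). A Boltzmann pair for $A,A^*$ is a pair $W,W^*$, with $W$ an invertible element of the algebra $\langle A\rangle$ generated by $A$ and $W^*$ an invertible element of $\langle A^*\rangle$, such that $WA^*W^{-1}=(W^*)^{-1}AW^*$ and $W^{-1}A^*W=W^*A(W^*)^{-1}$ (for a Leonard pair these two equations are equivalent); it is balanced if $WW^*W=W^*WW^*$. A spin Leonard pair is a Leonard pair for which a Boltzmann pair exists. Let $f,\tau_0,\dots,\tau_D$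 be nonzero complex numbers with $\tau_0=1$, and put $$W=f\sum_{i=0}^D\tau_iE_i,\qquad W^*(x)=f\sum_{i=0}^D\tau_iE_i^*(x)\quad(x\in X).$$ Assume that $f^{-2}=|X|^{-3/2}\sum_{i=0}^D k_i\tau_i$ and that, for every $x\in X$ and every irreducible $T(x)$-module $U$: (i) $U$ is thin; (ii) $U$ has the same endpoint and dual endpoint; (iii) the pair $A_1,A_1^*(x)$ acts on $U$ as a spin Leonard pair, and $W,W^*(x)$ acts on $U$ as a balanced Boltzmann pair for this spin Leonard pair. **Theorem.** The matrix $W$ is a spin model afforded by $\Gamma$. That is: * $W$ is symmetric with all entries nonzero, and for all $a,b,c\in X$ $$\sum_{y\in X}\frac{W(a,y)}{W(b,y)}=|X|\,\delta_{a,b},\qquad \sum_{y\in X}\frac{W(a,y)W(b,y)}{W(c,y)}=|X|^{1/2}\frac{W(a,b)}{W(a,c)\,W(b,c)};$$ * $W\in M\subseteq N(W)$, where $N(W)$ is the set of symmetric $B\in\mathrm{Mat}_X(\mathbb C)$ such that $B\mathbf u_{b,c}\in\mathbb C\,\mathbf u_{b,c}$ for all $b,c\in X$, with $\mathbf u_{b,c}=\sum_{y\in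 X}\frac{W(b,y)}{W(c,y)}\,\hat y$, where $\hat y\in V$ has $y$-entry $1$ and all other entries $0$. -/

import Mathlib

open scoped Matrix

noncomputable section

namespace SpinDRG

/-! ### Leonard pairs and Boltzmann pairs -/

section Leonard

variable {F : Type*} [Field F] {V : Type*} [AddCommGroup V] [Module F V]

/-- A square matrix is irreducible tridiagonal if all nonzero entries lie on the diagonal, the
subdiagonal or the superdiagonal, and all entries on the sub- and superdiagonal are nonzero. -/
def IsIrredTridiagonal {n : ℕ} (M : Matrix (Fin n) (Fin n) F) : Prop :=
  (∀ i j : Fin n, ((i : ℕ) + 1 < j ∨ (j : ℕ) + 1 < i) → M i j = 0) ∧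
  (∀ i j : Fin n, ((i : ℕ) + 1 = j ∨ (j : ℕ) + 1 = i) → M i j ≠ 0)

/-- The pair `A, A'` is a Leonard pair on `V`. (A basis indexed by `Fin (d + 1)` makes `V` of
finite positive dimension.) -/
def IsLeonardPair (A A' : Module.End F V) : Prop :=
  (∃ (d : ℕ) (b : Module.Basis (Fin (d + 1)) F V),
    IsIrredTridiagonal (LinearMap.toMatrix b b A) ∧ (LinearMap.toMatrix b b A').IsDiag) ∧
  (∃ (d : ℕ) (b : Module.Basis (Fin (d + 1)) F V),
    IsIrredTridiagonal (LinearMap.toMatrix b b A') ∧ (LinearMap.toMatrix b b A).IsDiag)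

/-- `W, W'` is a Boltzmann pair for the Leonard pair `A, A'`: `W` is an invertible element of the
algebra generated by `A`, `W'` is an invertible element of the algebra generated by `A'`, and
`W A' W⁻¹ = W'⁻¹ A W'`, `W⁻¹ A' W = W' A W'⁻¹`; these two equations are written below
without inverses. -/
structure IsBoltzmannPair (A A' W W' : Module.End F V) : Prop where
  mem : W ∈ Algebra.adjoin F {A}
  isUnit : IsUnit W
  mem' : W' ∈ Algebra.adjoin F {A'}
  isUnit' : IsUnit W'
  eq₁ : W' * W * A' = A * W' * W
  eq₂ : A' * W * W' = W * W' * A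

/-- A Leonard pair for which a Boltzmann pair exists. -/
def IsSpinLeonardPair (A A' : Module.End F V) : Prop :=
  IsLeonardPair A A' ∧ ∃ W W' : Module.End F V, IsBoltzmannPair A A' W W'

/-- A Boltzmann pair with `W W' W = W' W W'`. -/
def IsBalancedBoltzmannPair (A A' W W' : Module.End F V) : Prop :=
  IsBoltzmannPair A A' W W' ∧ W * W' * W = W' * W * W'

end Leonard

/-! ### Type II matrices, spin models -/

section Spin

variable {X : Type*} [Fintype X] [DecidableEq X]

/-- Type II matrices. -/
structure IsTypeII (W : Matrix X X ℂ) : Prop where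
  symm : W.IsSymm
  ne_zero : ∀ a b, W a b ≠ 0
  sum_eq : ∀ a b, ∑ y, W a y / W b y = if a = b then (Fintype.card X : ℂ) else 0

/-- Spin models: type II matrices that satisfy the type III condition. -/
structure IsSpinModel (W : Matrix X X ℂ) : Prop where
  typeII : IsTypeII W
  typeIII : ∀ a b c, ∑ y, W a y * W b y / W c y
    = ((Real.sqrt (Fintype.card X) : ℝ) : ℂ) * (W a b / (W a c * W b c))

/-- The column vector `u_{b,c}`, with `y`-entry `W(b,y) / W(c,y)`. -/
def uVec (W : Matrix X X ℂ) (b c : X) : X → ℂ := fun y => W b y / W c y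

/-- The Nomura algebra `N(W)` (as a set of matrices): the symmetric matrices that have every
`u_{b,c}` as an eigenvector. -/
def nomura (W : Matrix X X ℂ) : Set (Matrix X X ℂ) :=
  {B | B.IsSymm ∧ ∀ b c : X, ∃ μ : ℂ, B *ᵥ uVec W b c = μ • uVec W b c}

end Spin

/-! ### Distance-regular graphs -/

section Graph

variable {X : Type*} [Fintype X] (G : SimpleGraph X)

/-- A finite connected graph is distance-regular if the number of vertices at distance `i` from
`x` and at distance `j` from `y` depends only on `i`, `j` and the distance of `x` and `y`. -/
def IsDistanceRegular : Prop :=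
  G.Connected ∧ ∀ (i j : ℕ) (x y x' y' : X), G.dist x y = G.dist x' y' →
    Fintype.card {z : X // G.dist x z = i ∧ G.dist y z = j}
      = Fintype.card {z : X // G.dist x' z = i ∧ G.dist y' z = j}

/-- The `i`-th distance-matrix `A_i`. -/
def distMatrix (i : ℕ) : Matrix X X ℂ :=
  Matrix.of fun x y => if G.dist x y = i then 1 else 0

/-- The Bose-Mesner algebra `M`: the span of the distance-matrices `A_0, …, A_D`. -/
def boseMesner : Submodule ℂ (Matrix X X ℂ) :=
  Submodule.span ℂ (Set.range fun i : Fin (G.diam + 1) => distMatrix G i)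

/-- The graph `G` affords the matrix `W`: `W ∈ M ⊆ N(W)`. -/
def Affords (W : Matrix X X ℂ) : Prop :=
  W ∈ boseMesner G ∧ (boseMesner G : Set (Matrix X X ℂ)) ⊆ nomura W

variable [DecidableEq X]

/-- `E_0, …, E_D` is an ordering of the primitive idempotents of `G`: a basis of the Bose-Mesner
algebra consisting of mutually orthogonal idempotents with sum `I`, where `E_0 = |X|⁻¹ J`. -/
structure IsPrimitiveIdempotents (E : Fin (G.diam + 1) → Matrix X X ℂ) : Prop where
  linearIndependent : LinearIndependent ℂ E
  span_eq : Submodule.span ℂ (Set.range E) = boseMesner G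
  zero_eq : E 0 = (Fintype.card X : ℂ)⁻¹ • Matrix.of fun _ _ => 1
  idem : ∀ i, E i * E i = E i
  orth : ∀ i j, i ≠ j → E i * E j = 0
  sum_eq : ∑ i, E i = 1

/-- Formal self-duality with respect to `E_0, …, E_D`: the transition matrices `P`, `Q` with
`A_j = ∑ i, P_{ij} E_i` and `E_j = |X|⁻¹ ∑ i, Q_{ij} A_i` coincide. (When the `A_i` and the `E_i`
are bases of the same space, `P` and `Q` exist and are unique.) -/
def IsFormallySelfDual (E : Fin (G.diam + 1) → Matrix X X ℂ) : Prop :=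
  ∃ P Q : Matrix (Fin (G.diam + 1)) (Fin (G.diam + 1)) ℂ,
    (∀ j : Fin (G.diam + 1), distMatrix G j = ∑ i, P i j • E i) ∧
    (∀ j : Fin (G.diam + 1), E j = (Fintype.card X : ℂ)⁻¹ • ∑ i, Q i j • distMatrix G i) ∧
    P = Q

/-- The dual primitive idempotent `E*_i(x)`. -/
def dualIdem (x : X) (i : ℕ) : Matrix X X ℂ :=
  Matrix.diagonal fun y => if G.dist x y = i then 1 else 0

/-- The dual Bose-Mesner algebra `M*(x)`: the span of `E*_0(x), …, E*_D(x)`. -/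
def dualBoseMesner (x : X) : Submodule ℂ (Matrix X X ℂ) :=
  Submodule.span ℂ (Set.range fun i : Fin (G.diam + 1) => dualIdem G x i)

/-- The diagonal matrix with `(y,y)`-entry `|X| B(x,y)`. For `B = E_i` this is the dual
distance-matrix `A*_i(x)`. -/
def dualMatrix (x : X) (B : Matrix X X ℂ) : Matrix X X ℂ :=
  Matrix.diagonal fun y => (Fintype.card X : ℂ) * B x y

/-- The Terwilliger algebra `T(x)`, generated by `M` and `M*(x)`. -/
def terwilliger (x : X) : Subalgebra ℂ (Matrix X X ℂ) :=
  Algebra.adjoin ℂ ((boseMesner G : Set (Matrix X X ℂ)) ∪ (dualBoseMesner G x))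

/-- `U` is a `T(x)`-module, i.e. a `T(x)`-invariant subspace of the column vectors. -/
def IsTModule (x : X) (U : Submodule ℂ (X → ℂ)) : Prop :=
  ∀ B ∈ terwilliger G x, ∀ v ∈ U, B *ᵥ v ∈ U

/-- `U` is an irreducible `T(x)`-module. -/
def IsIrredTModule (x : X) (U : Submodule ℂ (X → ℂ)) : Prop :=
  IsTModule G x U ∧ U ≠ ⊥ ∧ ∀ U', IsTModule G x U' → U' ≤ U → U' = ⊥ ∨ U' = U

/-- The subspace `B U`. -/
def image (B : Matrix X X ℂ) (U : Submodule ℂ (X → ℂ)) : Submodule ℂ (X → ℂ) :=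
  U.map (Matrix.toLin' B)

/-- `U` is thin: `dim E*_i(x) U ≤ 1` for `0 ≤ i ≤ D`. -/
def IsThin (x : X) (U : Submodule ℂ (X → ℂ)) : Prop :=
  ∀ i : Fin (G.diam + 1), Module.finrank ℂ (image (dualIdem G x i) U) ≤ 1

/-- `r` is the endpoint of `U`, the least `i` with `E*_i(x) U ≠ 0`. -/
def IsEndpoint (x : X) (U : Submodule ℂ (X → ℂ)) (r : Fin (G.diam + 1)) : Prop :=
  IsLeast {i : Fin (G.diam + 1) | image (dualIdem G x i) U ≠ ⊥} r

variable {G} in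
/-- `s` is the dual endpoint of `U`, the least `i` with `E_i U ≠ 0`. -/
def IsDualEndpoint (E : Fin (G.diam + 1) → Matrix X X ℂ) (U : Submodule ℂ (X → ℂ))
    (s : Fin (G.diam + 1)) : Prop :=
  IsLeast {i : Fin (G.diam + 1) | image (E i) U ≠ ⊥} s

/-- The matrix `B` leaves `U` invariant, and acts on `U` as the linear map `b`. -/
def ActsAs (B : Matrix X X ℂ) (U : Submodule ℂ (X → ℂ)) (b : Module.End ℂ U) : Prop :=
  ∀ u : U, (b u : X → ℂ) = B *ᵥ (u : X → ℂ)

variable {G} in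
/-- `W = f ∑ i, τ_i E_i`. -/
def matW (E : Fin (G.diam + 1) → Matrix X X ℂ) (f : ℂ) (τ : Fin (G.diam + 1) → ℂ) :
    Matrix X X ℂ :=
  f • ∑ i, τ i • E i

/-- `W*(x) = f ∑ i, τ_i E*_i(x)`. -/
def matWDual (f : ℂ) (τ : Fin (G.diam + 1) → ℂ) (x : X) : Matrix X X ℂ :=
  f • ∑ i, τ i • dualIdem G x i

end Graph

end SpinDRG

end

namespace SpinDRG

open scoped Matrix
open Matrix

/-! ### Complete reducibility of the standard module. -/

section CompleteReducibility

variable {X : Type*} {G : SimpleGraph X}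

/-! The algebra `T(x)` is closed under conjugate transpose, so `V` is a sum of irreducible
`T(x)`-modules, and identities valid on each of them hold as matrix identities
(`eq_of_forall_irred`). Writing `A`, `A*`, `W*` for `A_1`, `A_1^*(x)`, `W^*(x)`, this gives `W* W A*
= A W* W`, `A* W W* = W W* A` and `W W* W = W* W W*` on all of `V`.

By the first relation with `x = c`, column `b` of `W*(c) W` is an eigenvector of `A`. For `b = c`
the eigenvalue is the valency, so the column is constant (`const_of_distMatrix_one_mulVec`); the
choice of `f` makes the constant `|X|^{1/2}`. Hence `W*(c)` has `y`-entry `|X|^{1/2} / W(c,y)`, and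
the other columns are multiples of the `u_{b,c}`. These are thus eigenvectors of `A`, and so of
every `A_i` (`exists_distMatrix_mulVec_eq_smul`).

The second relation, applied to the all-ones vector, gives the type II condition because the valency
is a simple eigenvalue (`eq_zero_of_eigenvalue_eq`). The third, read entrywise, is the type III
condition (`typeIII_of_braid`). -/

lemma distMatrix_conjTranspose (i : ℕ) : (distMatrix G i)ᴴ = distMatrix G i := by
  ext a b
  simp only [distMatrix, conjTranspose_apply, of_apply, G.dist_comm (u := b)]
  split_ifs <;> simp

lemma dualIdem_conjTranspose [DecidableEq X] (x : X) (i : ℕ) : (dualIdem G x i)ᴴ = dualIdem G x i := by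
  rw [dualIdem, diagonal_conjTranspose]
  congr 1
  ext y
  simp only [Pi.star_apply]
  split_ifs <;> simp

lemma conjTranspose_mem_span {ι : Type*} {b : ι → Matrix X X ℂ} (hb : ∀ i, (b i)ᴴ = b i)
    {B : Matrix X X ℂ} (hB : B ∈ Submodule.span ℂ (Set.range b)) :
    Bᴴ ∈ Submodule.span ℂ (Set.range b) := by
  induction hB using Submodule.span_induction with
  | mem B h =>
    obtain ⟨i, rfl⟩ := h
    rw [hb]
    exact Submodule.subset_span ⟨i, rfl⟩
  | zero => simp
  | add B C _ _ h₁ h₂ => rw [conjTranspose_add]; exact add_mem h₁ h₂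
  | smul a B _ h => rw [conjTranspose_smul]; exact Submodule.smul_mem _ _ h

variable [Fintype X]

/-- Both generating subspaces are spanned by Hermitian matrices. This closure is what makes
orthogonal complements of modules into modules. -/
lemma conjTranspose_mem_terwilliger [DecidableEq X] {x : X} {B : Matrix X X ℂ} (hB : B ∈ terwilliger G x) :
    Bᴴ ∈ terwilliger G x := by
  induction hB using Algebra.adjoin_induction with
  | mem B h =>
    refine Algebra.subset_adjoin ?_
    rcases h with h | h
    · exact Or.inl (conjTranspose_mem_span
        (b := fun i : Fin (G.diam + 1) => distMatrix G i) (fun i => distMatrix_conjTranspose _) h)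
    · exact Or.inr (conjTranspose_mem_span
        (b := fun i : Fin (G.diam + 1) => dualIdem G x i) (fun i => dualIdem_conjTranspose x _) h)
  | algebraMap r =>
    rw [Algebra.algebraMap_eq_smul_one, conjTranspose_smul, conjTranspose_one]
    exact (terwilliger G x).smul_mem (terwilliger G x).one_mem _
  | add B C _ _ h₁ h₂ => rw [conjTranspose_add]; exact (terwilliger G x).add_mem h₁ h₂
  | mul B C _ _ h₁ h₂ => rw [conjTranspose_mul]; exact (terwilliger G x).mul_mem h₂ h₁

/-- The vectors orthogonal to `U`, with respect to the standard Hermitian form. -/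
def orthVec (U : Submodule ℂ (X → ℂ)) : Submodule ℂ (X → ℂ) where
  carrier := {v | ∀ u ∈ U, star u ⬝ᵥ v = 0}
  add_mem' h₁ h₂ u hu := by rw [dotProduct_add, h₁ u hu, h₂ u hu, add_zero]
  zero_mem' u _ := dotProduct_zero _
  smul_mem' c v h u hu := by rw [dotProduct_smul, h u hu, smul_zero]

lemma exists_add_orthVec (U : Submodule ℂ (X → ℂ)) (v : X → ℂ) :
    ∃ p ∈ U, ∃ q ∈ orthVec U, v = p + q := by
  obtain ⟨p, hp, q, hq, h⟩ := (U.comap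
    (WithLp.linearEquiv 2 ℂ (X → ℂ)).toLinearMap).exists_add_mem_mem_orthogonal (WithLp.toLp 2 v)
  refine ⟨WithLp.ofLp p, hp, WithLp.ofLp q, fun u hu => ?_, ?_⟩
  · have := hq (WithLp.toLp 2 u) hu
    rwa [EuclideanSpace.inner_eq_star_dotProduct, dotProduct_comm] at this
  · simpa using congrArg WithLp.ofLp h

open scoped ComplexOrder in
lemma orthVec_inf_eq_bot (U : Submodule ℂ (X → ℂ)) : U ⊓ orthVec U = ⊥ := by
  rw [eq_bot_iff]
  rintro v ⟨h₁, h₂⟩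
  have := h₂ v h₁
  rwa [dotProduct_star_self_eq_zero] at this

lemma ActsAs.mul {U : Submodule ℂ (X → ℂ)} {B C : Matrix X X ℂ} {b c : Module.End ℂ U}
    (hB : ActsAs B U b) (hC : ActsAs C U c) : ActsAs (B * C) U (b * c) := by
  intro u
  rw [Module.End.mul_apply, hB, hC, mulVec_mulVec]

variable [DecidableEq X]

lemma IsTModule.orthVec {x : X} {U : Submodule ℂ (X → ℂ)} (hU : IsTModule G x U) :
    IsTModule G x (orthVec U) := by
  intro B hB v hv u hu
  have h := hv _ (hU _ (conjTranspose_mem_terwilliger hB) u hu)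
  rwa [star_mulVec, conjTranspose_conjTranspose, ← dotProduct_mulVec] at h

/-- Every `T(x)`-module is a sum of irreducible `T(x)`-modules. -/
lemma IsTModule.le_of_forall_irred {x : X} (K : Submodule ℂ (X → ℂ))
    (hK : ∀ U, IsIrredTModule G x U → U ≤ K) (U : Submodule ℂ (X → ℂ))
    (hU : IsTModule G x U) : U ≤ K := by
  induction hd : Module.finrank ℂ U using Nat.strong_induction_on generalizing U with
  | _ d ih =>
    by_cases h0 : U = ⊥
    · simp [h0]
    by_cases hirr : IsIrredTModule G x U
    · exact hK U hirr
    obtain ⟨U', hT, hle, hne, hne'⟩ :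
        ∃ U', IsTModule G x U' ∧ U' ≤ U ∧ U' ≠ ⊥ ∧ U' ≠ U := by
      by_contra hcon
      push Not at hcon
      refine hirr ⟨hU, h0, fun U' hT hle => ?_⟩
      by_cases hb : U' = ⊥
      · exact Or.inl hb
      · exact Or.inr (hcon U' hT hle hb)
    have hlt : U' < U := lt_of_le_of_ne hle hne'
    have hlt' : U ⊓ SpinDRG.orthVec U' < U := by
      refine lt_of_le_of_ne inf_le_left fun h => hne ?_
      rw [← orthVec_inf_eq_bot U', eq_comm, inf_eq_left]
      exact hle.trans (inf_eq_left.mp h)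
    have h₁ := ih _ (hd ▸ Submodule.finrank_lt_finrank_of_lt hlt) U' hT rfl
    have h₂ := ih _ (hd ▸ Submodule.finrank_lt_finrank_of_lt hlt') (U ⊓ SpinDRG.orthVec U')
      (fun B hB v hv => ⟨hU B hB v hv.1, hT.orthVec B hB v hv.2⟩) rfl
    intro v hv
    obtain ⟨p, hp, q, hq, rfl⟩ := exists_add_orthVec U' v
    exact add_mem (h₁ hp) (h₂ ⟨by simpa using sub_mem hv (hle hp), hq⟩)

/-- The vectors on which two matrices agree form a subspace; once it contains every irreducible
module, it contains the module `V` itself. -/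
lemma eq_of_forall_irred {x : X} {B C : Matrix X X ℂ}
    (h : ∀ U, IsIrredTModule G x U → ∀ u ∈ U, B *ᵥ u = C *ᵥ u) : B = C := by
  have hle := IsTModule.le_of_forall_irred (G := G) (x := x)
    (LinearMap.eqLocus (toLin' B) (toLin' C))
    (fun U hU u hu => by simpa using h U hU u hu) ⊤ (fun _ _ _ _ => trivial)
  exact toLin'.injective (LinearMap.ext fun v => hle trivial)

end CompleteReducibility

/-! ### Distance-matrices and their eigenvectors. -/

section DistanceRegular

variable {X : Type*} {G : SimpleGraph X}

lemma exists_adj_dist_eq (hc : G.Connected) {x y : X} {i : ℕ} (h : G.dist x y = i + 1) :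
    ∃ z, G.dist x z = 1 ∧ G.dist z y = i := by
  obtain ⟨p, hp⟩ := hc.exists_walk_length_eq_dist x y
  cases p with
  | nil => simp at h
  | @cons _ z _ hadj q =>
    have h1 := SimpleGraph.dist_eq_one_iff_adj.mpr hadj
    refine ⟨z, h1, ?_⟩
    have h2 := SimpleGraph.dist_le q
    have h3 := hc.dist_triangle (u := x) (v := z) (w := y)
    rw [SimpleGraph.Walk.length_cons] at hp
    omega

variable [Fintype X]

lemma dist_lt_diam_succ (hc : G.Connected) (x y : X) : G.dist x y < G.diam + 1 := by
  have := hc.nonempty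
  exact Nat.lt_succ_of_le (SimpleGraph.dist_le_diam (SimpleGraph.connected_iff_ediam_ne_top.mp hc))

/-- The distance of two vertices, as an element of `{0, …, D}`. -/
noncomputable def distFin (hc : G.Connected) (x y : X) : Fin (G.diam + 1) :=
  ⟨G.dist x y, dist_lt_diam_succ hc x y⟩

lemma dist_eq_iff (hc : G.Connected) (x y : X) (i : Fin (G.diam + 1)) :
    G.dist x y = i ↔ i = distFin hc x y := by
  rw [Fin.ext_iff, eq_comm]; rfl

lemma sum_smul_distMatrix_apply (hc : G.Connected) (c : Fin (G.diam + 1) → ℂ) (x y : X) :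
    (∑ i, c i • distMatrix G i) x y = c (distFin hc x y) := by
  simp [Matrix.sum_apply, distMatrix, dist_eq_iff hc]

/-- The triangle inequality stops the sum at `i + 1`, and the first step of a geodesic shows that
the top coefficient counts a nonempty set. -/
lemma exists_distMatrix_one_mul (hG : IsDistanceRegular G) (i : ℕ) :
    ∃ c : ℕ → ℂ, distMatrix G 1 * distMatrix G i =
        ∑ m ∈ Finset.range (i + 2), c m • distMatrix G m ∧
      ((∃ x y, G.dist x y = i + 1) → c (i + 1) ≠ 0) := by
  classical
  let N : X → X → ℕ := fun x y => Fintype.card {z : X // G.dist x z = 1 ∧ G.dist y z = i}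
  have hN : ∀ x y x' y', G.dist x y = G.dist x' y' → N x y = N x' y' :=
    fun x y x' y' h => hG.2 1 i x y x' y' h
  have hmul : ∀ x y, (distMatrix G 1 * distMatrix G i) x y = N x y := by
    intro x y
    simp only [mul_apply, distMatrix, of_apply, N, Fintype.card_subtype, G.dist_comm (v := y),
      ← ite_and, mul_ite, mul_one, mul_zero]
    simp [and_comm]
  -- The intersection number at distance `m`, read off from any pair at that distance; the default
  -- `0` is used for distances that do not occur.
  let c : ℕ → ℂ := fun m => if h : ∃ p : X × X, G.dist p.1 p.2 = m then
    N h.choose.1 h.choose.2 else 0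
  have hc : ∀ x y, c (G.dist x y) = N x y := by
    intro x y
    have h : ∃ p : X × X, G.dist p.1 p.2 = G.dist x y := ⟨(x, y), rfl⟩
    simp only [c, dif_pos h]
    rw [hN _ _ _ _ h.choose_spec]
  refine ⟨c, ?_, ?_⟩
  · ext x y
    rw [hmul, Matrix.sum_apply]
    simp only [distMatrix, Matrix.smul_apply, of_apply, smul_eq_mul, mul_ite, mul_one, mul_zero,
      Finset.sum_ite_eq, Finset.mem_range]
    split_ifs with h
    · exact (hc x y).symm
    · rw [Nat.cast_eq_zero]
      refine Fintype.card_eq_zero_iff.mpr ⟨fun ⟨z, hz, hz'⟩ => h ?_⟩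
      have := hG.1.dist_triangle (u := x) (v := z) (w := y)
      rw [G.dist_comm (u := z)] at this
      omega
  · rintro ⟨x, y, h⟩
    rw [← h, hc, Nat.cast_ne_zero]
    obtain ⟨z, hz, hz'⟩ := exists_adj_dist_eq hG.1 h
    exact (Fintype.card_pos_iff.mpr ⟨⟨z, hz, by rwa [G.dist_comm]⟩⟩).ne'

/-- The recurrence for `A_1 A_i` can be solved for `A_{i+1}` as long as distance `i + 1` occurs;
otherwise `A_{i+1} = 0`. -/
lemma exists_distMatrix_mulVec_eq_smul (hG : IsDistanceRegular G) {u : X → ℂ} {θ : ℂ}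
    (hu : distMatrix G 1 *ᵥ u = θ • u) (i : ℕ) :
    ∃ μ : ℂ, distMatrix G i *ᵥ u = μ • u := by
  classical
  induction i using Nat.strong_induction_on with
  | _ i ih =>
    rcases i with _ | i
    · refine ⟨1, ?_⟩
      have : distMatrix G 0 = 1 := by
        ext x y
        simp only [distMatrix, of_apply, one_apply, (hG.1 x y).dist_eq_zero_iff]
      rw [this, one_mulVec, one_smul]
    · by_cases hex : ∃ x y, G.dist x y = i + 1
      · obtain ⟨c, hc, hne⟩ := exists_distMatrix_one_mul hG i
        replace hne := hne hex
        have hlow : ∃ μ : ℂ, (∑ m ∈ Finset.range (i + 1), c m • distMatrix G m) *ᵥ u = μ • u := by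
          choose! μ hμ using ih
          refine ⟨∑ m ∈ Finset.range (i + 1), c m * μ m, ?_⟩
          rw [sum_mulVec, Finset.sum_smul]
          refine Finset.sum_congr rfl fun m hm => ?_
          rw [smul_mulVec, hμ m (Finset.mem_range.mp hm), smul_smul]
        obtain ⟨ν, hν⟩ := hlow
        obtain ⟨μ, hμ⟩ := ih i (Nat.lt_succ_self i)
        have h := congrArg (· *ᵥ u) hc
        simp only [Finset.sum_range_succ _ (i + 1), add_mulVec, hν, ← mulVec_mulVec, hμ,
          mulVec_smul, hu, smul_mulVec] at h
        refine ⟨(c (i + 1))⁻¹ * (μ * θ - ν), ?_⟩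
        rw [mul_smul, sub_smul, mul_smul, h, add_sub_cancel_left, smul_smul,
          inv_mul_cancel₀ hne, one_smul]
      · refine ⟨0, ?_⟩
        have : distMatrix G (i + 1) = 0 := by
          ext x y
          simp only [distMatrix, of_apply, Matrix.zero_apply, ite_eq_right_iff, one_ne_zero, imp_false]
          exact fun h => hex ⟨x, y, h⟩
        rw [this, zero_mulVec, zero_smul]

/-- In a connected regular graph, the eigenvectors of the valency are the constant vectors. -/
lemma const_of_distMatrix_one_mulVec (hc : G.Connected) {k : ℂ}
    (hk : ∀ x, (Fintype.card {y : X // G.dist x y = 1} : ℂ) = k) {v : X → ℂ}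
    (hv : distMatrix G 1 *ᵥ v = k • v) (x y : X) : v x = v y := by
  classical
  have hdeg : ∀ x, (G.degree x : ℂ) = k := by
    intro x
    rw [← hk x, ← SimpleGraph.card_neighborSet_eq_degree]
    congr 1
    exact Fintype.card_congr (Equiv.subtypeEquivRight fun y => by simp)
  have hsum : ∀ x, ∑ u ∈ G.neighborFinset x, v u = G.degree x * v x := by
    intro x
    have := congrFun hv x
    simp only [mulVec, dotProduct, distMatrix, of_apply, Pi.smul_apply, smul_eq_mul, ite_mul,
      one_mul, zero_mul, SimpleGraph.dist_eq_one_iff_adj] at this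
    rw [hdeg, ← this, ← Finset.sum_filter]
    congr 1
    ext u
    simp
  -- The real and imaginary parts of `v` lie in the kernel of the real Laplacian, whose elements are
  -- constant on connected components.
  have hre : ∀ φ : ℂ →ₗ[ℝ] ℝ, φ (v x) = φ (v y) := by
    intro φ
    refine (G.lapMatrix_mulVec_eq_zero_iff_forall_reachable
      (x := fun z => φ (v z))).mp ?_ x y (hc x y)
    ext z
    rw [SimpleGraph.lapMatrix_mulVec_apply, ← map_sum, hsum z]
    have : (G.degree z : ℂ) * v z = (G.degree z : ℝ) • v z := by simp
    rw [this, map_smul]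
    simp
  exact Complex.ext (hre Complex.reLm) (hre Complex.imLm)

end DistanceRegular

/-! ### Eigenvalues, idempotents and formal self-duality. -/

section SelfDual

variable {X : Type*} [Fintype X] {G : SimpleGraph X}
  {E : Fin (G.diam + 1) → Matrix X X ℂ}
  {P : Matrix (Fin (G.diam + 1)) (Fin (G.diam + 1)) ℂ}

lemma matW_apply (hc : G.Connected)
    (hQ : ∀ j : Fin (G.diam + 1),
      E j = (Fintype.card X : ℂ)⁻¹ • ∑ i, P i j • distMatrix G i)
    (f : ℂ) (τ : Fin (G.diam + 1) → ℂ) (x y : X) :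
    matW E f τ x y = f * (Fintype.card X : ℂ)⁻¹ * ∑ j, τ j * P (distFin hc x y) j := by
  have hEa : ∀ j, E j x y = (Fintype.card X : ℂ)⁻¹ * P (distFin hc x y) j := by
    intro j
    conv_lhs => rw [hQ j, Matrix.smul_apply]
    rw [sum_smul_distMatrix_apply hc (fun i => P i j), smul_eq_mul]
  rw [matW, Matrix.smul_apply, Matrix.sum_apply, smul_eq_mul, mul_assoc, Finset.mul_sum _ _ (_⁻¹)]
  congr 1
  refine Finset.sum_congr rfl fun j _ => ?_
  rw [Matrix.smul_apply, smul_eq_mul, hEa]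
  ring

variable [DecidableEq X]

lemma distMatrix_mul_idem (hE : IsPrimitiveIdempotents G E)
    (hP : ∀ j : Fin (G.diam + 1), distMatrix G j = ∑ i, P i j • E i) (i j : Fin (G.diam + 1)) :
    distMatrix G j * E i = P i j • E i := by
  rw [hP, Finset.sum_mul, Finset.sum_eq_single i]
  · rw [smul_mul_assoc, hE.idem]
  · intro l _ hl
    rw [smul_mul_assoc, hE.orth l i hl, smul_zero]
  · simp

/-- Since `E_0` is a multiple of `J`, the equation `A_j E_0 = P_{0j} E_0` reads off the row sums of
`A_j`. -/
lemma card_sphere_eq (hc : G.Connected) (hE : IsPrimitiveIdempotents G E)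
    (hP : ∀ j : Fin (G.diam + 1), distMatrix G j = ∑ i, P i j • E i) (x : X)
    (j : Fin (G.diam + 1)) : (Fintype.card {y : X // G.dist x y = j} : ℂ) = P 0 j := by
  have := hc.nonempty
  have hn : (Fintype.card X : ℂ) ≠ 0 := Nat.cast_ne_zero.mpr Fintype.card_ne_zero
  have h := congrFun (congrFun (distMatrix_mul_idem hE hP 0 j) x) x
  rw [hE.zero_eq] at h
  simp only [mul_apply, distMatrix, of_apply, Matrix.smul_apply, smul_eq_mul, mul_one, ← Finset.sum_mul]
    at h
  rw [← mul_right_cancel₀ (inv_ne_zero hn) h, Fintype.card_subtype, Finset.sum_boole]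

/-- The valency is a simple eigenvalue. -/
lemma eq_zero_of_eigenvalue_eq (hc : G.Connected) (hD : 1 ≤ G.diam)
    (hE : IsPrimitiveIdempotents G E)
    (hP : ∀ j : Fin (G.diam + 1), distMatrix G j = ∑ i, P i j • E i) {i : Fin (G.diam + 1)}
    (h : P i 1 = P 0 1) : i = 0 := by
  by_contra hi
  have := hc.nonempty
  have hn : (Fintype.card X : ℂ) ≠ 0 := Nat.cast_ne_zero.mpr Fintype.card_ne_zero
  -- The numeral is reduced modulo `D + 1`, so `D ≥ 1` is needed here.
  have h1 : ((1 : Fin (G.diam + 1)) : ℕ) = 1 := by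
    rw [Fin.val_one', Nat.mod_eq_of_lt (by omega)]
  have hA := distMatrix_mul_idem hE hP i 1
  have hk := fun x => card_sphere_eq hc hE hP x 1
  rw [h1] at hA
  simp only [h1] at hk
  rw [h] at hA
  -- The columns of `E_i` are eigenvectors for the valency, hence constant; `E_0 E_i = 0` then makes
  -- them zero.
  have hcol : ∀ a b c, E i a c = E i b c := by
    intro a b c
    refine const_of_distMatrix_one_mulVec hc hk (v := fun y => E i y c) ?_ a b
    ext y
    exact congrFun (congrFun hA y) c
  refine hE.linearIndependent.ne_zero i ?_
  ext a c
  have h0 := congrFun (congrFun (hE.orth 0 i (Ne.symm hi)) a) c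
  rw [hE.zero_eq] at h0
  simp only [mul_apply, Matrix.smul_apply, of_apply, smul_eq_mul, mul_one, hcol _ a c, Finset.sum_const,
    Finset.card_univ, nsmul_eq_mul, Matrix.zero_apply] at h0
  rwa [mul_inv_cancel_left₀ hn] at h0

lemma matWDual_eq_diagonal (hc : G.Connected) (f : ℂ) (τ : Fin (G.diam + 1) → ℂ) (x : X) :
    matWDual G f τ x = diagonal fun y => f * τ (distFin hc x y) := by
  ext a b
  rw [matWDual, Matrix.smul_apply, Matrix.sum_apply]
  rcases eq_or_ne a b with rfl | hab
  · simp [dualIdem, dist_eq_iff hc]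
  · simp [dualIdem, hab]

end SelfDual

/-! ### From the braid relation to the spin model. -/

section SpinModel

variable {X : Type*} [Fintype X] [DecidableEq X]

/-- If `r / W(c,y)` is the `y`-entry of a diagonal matrix which satisfies the braid relation with
`W` for all `c`, where `r² = |X|`, then `W` satisfies the type III condition. -/
lemma typeIII_of_braid {W : Matrix X X ℂ} (hsymm : W.IsSymm) {r : ℂ} (hr : r ≠ 0)
    {Δ : X → X → ℂ} (hΔ : ∀ c y, Δ c y * W c y = r)
    (hbraid : ∀ c, W * diagonal (Δ c) * W = diagonal (Δ c) * W * diagonal (Δ c)) (a b c : X) :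
    ∑ y, W a y * W b y / W c y = r * (W a b / (W a c * W b c)) := by
  have hne : ∀ c y, W c y ≠ 0 := fun c y h => hr (by rw [← hΔ c y, h, mul_zero])
  have hΔ' : ∀ c y, Δ c y = r / W c y := fun c y => by rw [eq_div_iff (hne c y), hΔ]
  have h := congrFun (congrFun (hbraid c) a) b
  rw [mul_diagonal, diagonal_mul, mul_apply] at h
  simp only [mul_diagonal, hΔ', hsymm.apply b] at h
  have hs : ∑ y, W a y * (r / W c y) * W b y = r * ∑ y, W a y * W b y / W c y := by
    rw [Finset.mul_sum]
    exact Finset.sum_congr rfl fun y _ => by ring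
  rw [hs] at h
  refine mul_left_cancel₀ hr (h.trans ?_)
  rw [hsymm.apply c a, hsymm.apply c b, hsymm.apply a b]
  field_simp

end SpinModel

end SpinDRG

theorem theorem13p8 {X : Type*} [Fintype X] [DecidableEq X] (G : SimpleGraph X)
    (hG : SpinDRG.IsDistanceRegular G) (hD : 1 ≤ G.diam)
    (E : Fin (G.diam + 1) → Matrix X X ℂ)
    (hE : SpinDRG.IsPrimitiveIdempotents G E)
    (hsd : SpinDRG.IsFormallySelfDual G E)
    (f : ℂ) (τ : Fin (G.diam + 1) → ℂ) (hf : f ≠ 0) (hτ : ∀ i, τ i ≠ 0) (hτ0 : τ 0 = 1)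
    (hthin : ∀ (x : X) (U : Submodule ℂ (X → ℂ)), SpinDRG.IsIrredTModule G x U →
      SpinDRG.IsThin G x U)
    (hend : ∀ (x : X) (U : Submodule ℂ (X → ℂ)), SpinDRG.IsIrredTModule G x U →
      ∃ r, SpinDRG.IsEndpoint G x U r ∧ SpinDRG.IsDualEndpoint E U r)
    (hspin : ∀ (x : X) (U : Submodule ℂ (X → ℂ)), SpinDRG.IsIrredTModule G x U →
      ∃ a a' w w' : Module.End ℂ U,
        SpinDRG.ActsAs (SpinDRG.distMatrix G 1) U a ∧
        SpinDRG.ActsAs (SpinDRG.dualMatrix x (E 1)) U a' ∧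
        SpinDRG.ActsAs (SpinDRG.matW E f τ) U w ∧
        SpinDRG.ActsAs (SpinDRG.matWDual G f τ x) U w' ∧
        SpinDRG.IsSpinLeonardPair a a' ∧
        SpinDRG.IsBalancedBoltzmannPair a a' w w')
    (hf2 : ∀ x : X, (f ^ 2)⁻¹ = (((Fintype.card X : ℝ) ^ (-(3 / 2) : ℝ) : ℝ) : ℂ) *
      ∑ i : Fin (G.diam + 1), (Fintype.card {y : X // G.dist x y = i} : ℂ) * τ i) :
    SpinDRG.IsSpinModel (SpinDRG.matW E f τ) ∧ SpinDRG.Affords G (SpinDRG.matW E f τ) := by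

  classical
  obtain ⟨hc, -⟩ := id hG
  have := hc.nonempty
  obtain ⟨P, Q, hP, hQ, rfl⟩ := hsd
  have h1 : ((1 : Fin (G.diam + 1)) : ℕ) = 1 := by
    rw [Fin.val_one', Nat.mod_eq_of_lt (by omega)]
  have hk : ∀ x, (Fintype.card {y : X // G.dist x y = 1} : ℂ) = P 0 1 := fun x => by
    simpa only [h1] using SpinDRG.card_sphere_eq hc hE hP x 1
  set n : ℂ := (Fintype.card X : ℂ) with hn_def
  have hn : n ≠ 0 := Nat.cast_ne_zero.mpr Fintype.card_ne_zero
  set r : ℂ := ((Real.sqrt (Fintype.card X) : ℝ) : ℂ) with hr_def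
  have hrr : r * r = n := by
    rw [hr_def, ← Complex.ofReal_mul, Real.mul_self_sqrt (Nat.cast_nonneg _)]
    simp [hn_def]
  have hr : r ≠ 0 := fun h => hn (by rw [← hrr, h, zero_mul])
  have hd0 : ∀ x : X, SpinDRG.distFin hc x x = 0 := fun x =>
    ((SpinDRG.dist_eq_iff hc x x 0).mp (by simp)).symm
  -- Self-duality: the entries of `A_1^*(x)` are the eigenvalues of `A_1`.
  have hE1 : ∀ x y, n * E 1 x y = P (SpinDRG.distFin hc x y) 1 := by
    intro x y
    conv_lhs => rw [hQ 1, Matrix.smul_apply]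
    rw [SpinDRG.sum_smul_distMatrix_apply hc (fun i => P i 1), smul_eq_mul,
      mul_inv_cancel_left₀ hn]
  have hWapp := SpinDRG.matW_apply (P := P) hc hQ f τ
  set W := SpinDRG.matW E f τ with hW_def
  have hsymm : W.IsSymm := by
    refine Matrix.IsSymm.ext fun a b => ?_
    have : SpinDRG.distFin hc b a = SpinDRG.distFin hc a b := Fin.ext G.dist_comm
    rw [hWapp, hWapp, this]
  let Δ : X → X → ℂ := fun x y => f * τ (SpinDRG.distFin hc x y)
  have hΔW : ∀ x, SpinDRG.matWDual G f τ x = Matrix.diagonal (Δ x) :=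
    SpinDRG.matWDual_eq_diagonal hc f τ
  let θ : X → X → ℂ := fun x y => P (SpinDRG.distFin hc x y) 1
  have hθ : ∀ x, SpinDRG.dualMatrix x (E 1) = Matrix.diagonal (θ x) := by
    intro x
    rw [SpinDRG.dualMatrix]
    congr 1
    ext y
    exact hE1 x y
  set A := SpinDRG.distMatrix G 1 with hA_def
  have hrel : ∀ x,
      Matrix.diagonal (Δ x) * W * Matrix.diagonal (θ x) = A * Matrix.diagonal (Δ x) * W ∧
      Matrix.diagonal (θ x) * W * Matrix.diagonal (Δ x) = W * Matrix.diagonal (Δ x) * A ∧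
      W * Matrix.diagonal (Δ x) * W = Matrix.diagonal (Δ x) * W * Matrix.diagonal (Δ x) := by
    intro x
    refine ⟨?_, ?_, ?_⟩ <;>
    · refine SpinDRG.eq_of_forall_irred (G := G) (x := x) fun U hU u hu => ?_
      obtain ⟨a, a', w, w', ha, ha', hw, hw', -, hB, hbal⟩ := hspin x U hU
      rw [hΔW] at hw'
      rw [hθ] at ha'
      first
      | exact (((hw'.mul hw).mul ha') ⟨u, hu⟩).symm.trans
          ((congrArg (fun b : Module.End ℂ U => (b ⟨u, hu⟩ : X → ℂ)) hB.eq₁).trans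
            (((ha.mul hw').mul hw) ⟨u, hu⟩))
      | exact (((ha'.mul hw).mul hw') ⟨u, hu⟩).symm.trans
          ((congrArg (fun b : Module.End ℂ U => (b ⟨u, hu⟩ : X → ℂ)) hB.eq₂).trans
            (((hw.mul hw').mul ha) ⟨u, hu⟩))
      | exact (((hw.mul hw').mul hw) ⟨u, hu⟩).symm.trans
          ((congrArg (fun b : Module.End ℂ U => (b ⟨u, hu⟩ : X → ℂ)) hbal).trans
            (((hw'.mul hw).mul hw') ⟨u, hu⟩))
  -- `W*(c) W b̂` is an eigenvector of `A`
  have heig : ∀ b c, A *ᵥ (fun y => Δ c y * W y b) = θ c b • fun y => Δ c y * W y b := by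
    intro b c
    ext y
    have h := congrFun (congrFun (hrel c).1 y) b
    rw [Matrix.mul_diagonal, Matrix.diagonal_mul, Matrix.mul_assoc, Matrix.mul_apply] at h
    simp only [Matrix.diagonal_mul] at h
    rw [Pi.smul_apply, smul_eq_mul, mul_comm]
    exact h.symm
  -- The product is `f² |X|⁻¹ ∑ k_j τ_j`, which the normalization of `f` turns into `|X|^{1/2}`.
  have hdiag : ∀ x, Δ x x * W x x = r := by
    intro x
    have hsum : ∑ j, τ j * P (SpinDRG.distFin hc x x) j
        = ∑ i : Fin (G.diam + 1), (Fintype.card {y : X // G.dist x y = i} : ℂ) * τ i := by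
      refine Finset.sum_congr rfl fun j _ => ?_
      rw [SpinDRG.card_sphere_eq hc hE hP x j, hd0, mul_comm]
    have hpow : (((Fintype.card X : ℝ) ^ (-(3 / 2) : ℝ) : ℝ) : ℂ) = (n * r)⁻¹ := by
      have hpos : (0 : ℝ) < Fintype.card X := Nat.cast_pos.mpr Fintype.card_pos
      rw [Real.rpow_neg hpos.le, show (3 / 2 : ℝ) = 1 + 1 / 2 by norm_num, Real.rpow_add hpos,
        Real.rpow_one, ← Real.sqrt_eq_rpow, hr_def, hn_def]
      push_cast
      rfl
    have h2 := hf2 x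
    rw [hpow] at h2
    have h3 : ∑ i : Fin (G.diam + 1), (Fintype.card {y : X // G.dist x y = i} : ℂ) * τ i
        = n * r * (f ^ 2)⁻¹ := by
      rw [h2, mul_inv_cancel_left₀ (mul_ne_zero hn hr)]
    rw [hWapp, hsum, h3]
    simp only [Δ, hd0, hτ0]
    field_simp
    rfl
  have hΔ : ∀ x y, Δ x y * W x y = r := by
    intro x y
    -- For `b = c` the eigenvalue is the valency, so the eigenvector is constant and equals its
    -- diagonal value.
    have h := heig x x
    have hθ0 : θ x x = P 0 1 := by simp only [θ, hd0]
    rw [hθ0] at h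
    have := SpinDRG.const_of_distMatrix_one_mulVec hc hk h y x
    rw [hdiag, hsymm.apply] at this
    exact this
  have hne : ∀ x y, W x y ≠ 0 := fun x y h => hr (by rw [← hΔ x y, h, mul_zero])
  have hΔ' : ∀ x y, Δ x y = r / W x y := fun x y => by rw [eq_div_iff (hne x y), hΔ]
  refine ⟨⟨⟨hsymm, hne, fun a b => ?_⟩, fun a b c => ?_⟩, ?_, ?_⟩
  · rcases eq_or_ne a b with rfl | hab
    · rw [if_pos rfl]
      simp [div_self (hne a _)]
    rw [if_neg hab]
    -- `W W*(b) 1` is an eigenvector of `A*(b)`, so its support is `{b}`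
    have hcol : ∀ y, ∑ z, A y z = P 0 1 := by
      intro y
      rw [← hk y, Fintype.card_subtype]
      simp [hA_def, SpinDRG.distMatrix]
    have h := congrFun (congrArg (fun B : Matrix X X ℂ => B *ᵥ (fun _ => 1)) (hrel b).2.1) a
    have hA1 : A *ᵥ (fun _ => (1 : ℂ)) = P 0 1 • fun _ => 1 := by
      ext y
      simp [Matrix.mulVec, dotProduct, hcol]
    have hS : ((W * Matrix.diagonal (Δ b)) *ᵥ fun _ => (1 : ℂ)) a = r * ∑ y, W a y / W b y := by
      simp only [Matrix.mulVec, dotProduct, Matrix.mul_diagonal, mul_one, hΔ', Finset.mul_sum]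
      exact Finset.sum_congr rfl fun y _ => by ring
    simp only [Matrix.mul_assoc] at h
    simp only [← Matrix.mulVec_mulVec, hA1, Matrix.mulVec_smul] at h
    rw [Matrix.mulVec_diagonal, Pi.smul_apply, Matrix.mulVec_mulVec, hS, smul_eq_mul] at h
    -- A nonzero entry at `a` forces the eigenvalue at distance `∂(b,a)` to be the valency, that is,
    -- `a = b`.
    by_contra h0
    have hθeq : θ b a = P 0 1 := mul_right_cancel₀ (mul_ne_zero hr h0) h
    have hd := SpinDRG.eq_zero_of_eigenvalue_eq hc hD hE hP hθeq
    have hba : G.dist b a = 0 := (SpinDRG.dist_eq_iff hc b a 0).mpr hd.symm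
    exact hab ((hc b a).dist_eq_zero_iff.mp hba).symm
  · exact SpinDRG.typeIII_of_braid hsymm hr hΔ (fun c => (hrel c).2.2) a b c
  · rw [← hE.span_eq]
    exact Submodule.smul_mem _ _ (Submodule.sum_mem _ fun i _ =>
      Submodule.smul_mem _ _ (Submodule.subset_span ⟨i, rfl⟩))
  · intro B hB
    have hu : ∀ b c, A *ᵥ SpinDRG.uVec W b c = θ c b • SpinDRG.uVec W b c := by
      intro b c
      have hv : SpinDRG.uVec W b c = r⁻¹ • fun y => Δ c y * W y b := by
        ext y
        rw [SpinDRG.uVec, Pi.smul_apply, smul_eq_mul, hΔ', hsymm.apply b y]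
        field_simp
      rw [hv, Matrix.mulVec_smul, heig, smul_comm]
    refine Submodule.span_induction (p := fun B _ => B ∈ SpinDRG.nomura W) ?_ ?_ ?_ ?_ hB
    · rintro _ ⟨i, rfl⟩
      refine ⟨Matrix.IsSymm.ext fun a b => ?_, fun b c =>
        SpinDRG.exists_distMatrix_mulVec_eq_smul hG (hu b c) i⟩
      simp only [SpinDRG.distMatrix, Matrix.of_apply, G.dist_comm (u := a)]
    · exact ⟨Matrix.isSymm_zero, fun b c => ⟨0, by simp⟩⟩
    · rintro B C - - ⟨hB, hB'⟩ ⟨hC, hC'⟩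
      refine ⟨hB.add hC, fun b c => ?_⟩
      obtain ⟨μ, hμ⟩ := hB' b c
      obtain ⟨ν, hν⟩ := hC' b c
      exact ⟨μ + ν, by rw [Matrix.add_mulVec, hμ, hν, add_smul]⟩
    · rintro s B - ⟨hB, hB'⟩
      refine ⟨hB.smul s, fun b c => ?_⟩
      obtain ⟨μ, hμ⟩ := hB' b c
      exact ⟨s * μ, by rw [Matrix.smul_mulVec, hμ, smul_smul]⟩
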